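/- Let $p$ be a prime, let $D$ be a division ring of characteristic $p$ with center $C$, of finite dimension $n^2$ over $C$, and let $\delta\colon D\to D$ be a derivation. Put $F=\{c\in C:\delta(c)=0\}$, and suppose that the $F$-linear endomorphism $\delta|_C$ of $C$ is algebraic over $F$ with minimum polynomial of degree $p^e$. Let $R=D[t;\delta]$ be the differential polynomial ring (elements $\sum a_it^i$ with $a_i\in D$, product determined by $ta=at+\delta(a)$), and let $f\in R$ have degree $m\ge 2$. Let $S_f$ be the Petit algebra: the space $R_m=\{g\in R:\deg g<m\}$ with the product $g\circ h=$ the remainder $r$ of $gh=qf+r$, $\deg r<m$. For a nonassociative ring $A$ with associator $[x,y,z]=(xy)z-x(yz)$, write $\mathrm{Nuc}_l(A)=\{x:[x,A,A]=0\}$, $\mathrm{Nuc}_m(A)=\{x:[A,x,A]=0\}$, $\mathrm{Nuc}_r(A)=\{x:[A,A,x]=0\}$. Call $f$ semi-invariant if for every $a\in D$ there is $b\in D$ with $fa=bf$, and two-sided if moreover $ft=(ct+d)f$ for some $c,d\in D$. Call $A\neq 0$ a division algebra if left and right multiplication by every nonzero element are bijective. Then: (i) $S_f$ is a unital (nonassociative)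 $F$-algebra of dimension $mn^2p^e$, with unit the constant polynomial $1$. If $f$ is irreducible in $R$, then $S_f$ is a division algebra. If $f$ is not two-sided, then $\mathrm{Nuc}_l(S_f)=\mathrm{Nuc}_m(S_f)=D$ (the constant polynomials). Moreover $D\subseteq\mathrm{Nuc}_r(S_f)$ if and only if $f$ is semi-invariant; in particular $D$ is not contained in the right nucleus if $f$ is not semi-invariant. (ii) If $f\in F[t]$, then $q+(f)\mapsto q \bmod_r f$ is an injective unital homomorphism of $F$-algebras from $F[t]/(f)$ to $S_f$, with image $F\oplus Ft\oplus\dots\oplus Ft^{m-1}$, and this image is contained in $\mathrm{Nuc}_r(S_f)$. If moreover $f$ is irreducible in $F[t]$, then $F[t]/(f)$ is a field of degree $m$ over $F$. (iii) If $f\in C[t;\delta|_C]$, then the inclusion of coefficients $C\subseteq D$ induces an injective unital homomorphism of $F$-algebras from the Petit algebra $C[t;\delta|_C]/C[t;\delta|_C]f$ (formed over $C$) to $S_f$, and the former has dimension $mp^e$ over $F$. -/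

import Mathlib

open Polynomial

noncomputable section

/-- A derivation of a (not necessarily commutative) ring. -/
structure RingDer (D : Type*) [Ring D] extends D →+ D where
  leibniz' : ∀ a b, toFun (a * b) = a * toFun b + toFun a * b

namespace RingDer

instance {D : Type*} [Ring D] : CoeFun (RingDer D) (fun _ => D → D) := ⟨fun δ => δ.toAddMonoidHom⟩

section ring

variable {D : Type*} [Ring D] (δ : RingDer D)

theorem leibniz (a b : D) : δ (a * b) = a * δ b + δ a * b := δ.leibniz' a b

theorem map_one : δ 1 = 0 := by
  have h := δ.leibniz 1 1
  simpa using h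

theorem map_mem_center {c : D} (hc : c ∈ Subring.center D) : δ c ∈ Subring.center D := by
  rw [Subring.mem_center_iff] at hc ⊢
  intro g
  have h := congrArg δ (hc g)
  rw [δ.leibniz, δ.leibniz, hc (δ g), add_comm (c * δ g)] at h
  exact add_right_cancel h

/-- The restriction of a derivation to the center. -/
def toCenter : RingDer (Subring.center D) where
  toFun c := ⟨δ c, δ.map_mem_center c.2⟩
  map_zero' := Subtype.ext (map_zero δ.toAddMonoidHom)
  map_add' _ _ := Subtype.ext (map_add δ.toAddMonoidHom _ _)
  leibniz' _ _ := Subtype.ext (δ.leibniz _ _)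

end ring

section division

variable {D : Type*} [DivisionRing D] (δ : RingDer D)

/-- The field `F` of those central elements `c` of `D` with `δ c = 0`. -/
def constField : Subfield (Subring.center D) where
  carrier := {c | δ (c : D) = 0}
  mul_mem' {a b} ha hb := by
    change δ ((a : D) * b) = 0
    rw [δ.leibniz, show δ (a : D) = 0 from ha, show δ (b : D) = 0 from hb]; simp
  one_mem' := δ.map_one
  add_mem' {a b} ha hb := by
    change δ ((a : D) + b) = 0
    rw [map_add, show δ (a : D) = 0 from ha, show δ (b : D) = 0 from hb]; simp
  zero_mem' := map_zero δ.toAddMonoidHom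
  neg_mem' {a} ha := by
    change δ (-(a : D)) = 0
    rw [map_neg, show δ (a : D) = 0 from ha, neg_zero]
  inv_mem' a ha := by
    change δ ((a⁻¹ : Subring.center D) : D) = 0
    by_cases h0 : a = 0
    · subst h0; simp
    · have h1 : (a : D) * ((a⁻¹ : Subring.center D) : D) = 1 := by
        exact congrArg Subtype.val (mul_inv_cancel₀ h0)
      have h2 := congrArg δ h1
      rw [δ.leibniz, δ.map_one, show δ (a : D) = 0 from ha, zero_mul, add_zero] at h2
      have h3 : (a : D) ≠ 0 := fun h => h0 (Subtype.ext h)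
      exact (mul_eq_zero.mp h2).resolve_left h3

/-- The restriction of `δ` to the center `C` of `D`, as an `F`-linear endomorphism of `C`. -/
def centerLin : Module.End δ.constField (Subring.center D) where
  toFun := δ.toCenter
  map_add' := map_add δ.toCenter.toAddMonoidHom
  map_smul' c x := by
    change δ.toCenter ((c : Subring.center D) * x) = (c : Subring.center D) * δ.toCenter x
    have hc : δ.toCenter (c : Subring.center D) = 0 := Subtype.ext c.2
    rw [δ.toCenter.leibniz, hc, zero_mul, add_zero]

end division

end RingDer

/-- The differential polynomial ring `D[t;δ]`. Its elements are the polynomials `∑ aᵢ tⁱ` with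
coefficients on the left, with termwise addition; see `DiffPoly.mul_def` for the product. -/
def DiffPoly {D : Type*} [Ring D] (_δ : RingDer D) : Type _ := D[X]

namespace DiffPoly

section ring

variable {D : Type*} [Ring D] (δ : RingDer D)

theorem end_add (A B : AddMonoid.End D[X]) (x : D[X]) : (A + B) x = A x + B x := rfl

theorem end_mul (A B : AddMonoid.End D[X]) (x : D[X]) : (A * B) x = A (B x) := rfl

theorem end_zero (x : D[X]) : (0 : AddMonoid.End D[X]) x = 0 := rfl

theorem end_one (x : D[X]) : (1 : AddMonoid.End D[X]) x = x := rfl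

theorem end_sum (s : Finset ℕ) (A : ℕ → AddMonoid.End D[X]) (x : D[X]) :
    (∑ i ∈ s, A i) x = ∑ i ∈ s, A i x := by
  classical
  induction s using Finset.induction_on with
  | empty => rfl
  | insert a s ha ih => rw [Finset.sum_insert ha, Finset.sum_insert ha, end_add, ih]

/-- Left multiplication of polynomials by `t`: as `t a = a t + δ a`, it is
`∑ aᵢ tⁱ ↦ ∑ (aᵢ tⁱ⁺¹ + δ(aᵢ) tⁱ)`. -/
def tMul : AddMonoid.End D[X] where
  toFun g := g * X + g.sum fun i a => monomial i (δ a)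
  map_zero' := by simp
  map_add' g h := by
    rw [Polynomial.sum_add_index]
    · rw [add_mul]; abel
    · simp
    · simp

/-- Left multiplication of polynomials by a constant. -/
def cMul (a : D) : AddMonoid.End D[X] := AddMonoidHom.mulLeft (Polynomial.C a)

theorem cMul_apply (a : D) (g : D[X]) : cMul a g = Polynomial.C a * g := rfl

/-- Left multiplication by the differential polynomial `∑ aᵢ tⁱ`: the sum of the
`(left multiplication by aᵢ) ∘ (left multiplication by t)ⁱ`. -/
def lMul : D[X] →+ AddMonoid.End D[X] where
  toFun f := f.sum fun i a => cMul a * tMul δ ^ i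
  map_zero' := by simp
  map_add' f g := by
    refine Polynomial.sum_add_index _ _ _ (fun i => ?_) (fun i a b => ?_)
    · ext1 x; rw [end_mul, cMul_apply, Polynomial.C_0, zero_mul, end_zero]
    · rw [← add_mul]; congr 1; ext1 x
      rw [end_add, cMul_apply, cMul_apply, cMul_apply, Polynomial.C_add, add_mul]

theorem coeff_der (g : D[X]) (k : ℕ) :
    (g.sum fun i a => monomial i (δ a)).coeff k = δ (g.coeff k) := by
  rw [Polynomial.sum_def, finsetSum_coeff]
  simp only [coeff_monomial]
  rw [Finset.sum_ite_eq']
  split_ifs with h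
  · rfl
  · rw [notMem_support_iff.mp h, map_zero]

theorem tMul_apply (g : D[X]) :
    tMul δ g = g * X + g.sum fun i a => monomial i (δ a) := rfl

theorem coeff_tMul_succ (g : D[X]) (k : ℕ) :
    (tMul δ g).coeff (k + 1) = g.coeff k + δ (g.coeff (k + 1)) := by
  rw [tMul_apply, coeff_add, coeff_der, coeff_mul_X]

theorem tMul_cMul (a : D) : tMul δ * cMul a = cMul a * tMul δ + cMul (δ a) := by
  ext1 g
  ext k
  simp only [end_mul, end_add, cMul_apply, tMul_apply, coeff_add, coeff_C_mul, coeff_der,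
    δ.leibniz, mul_assoc, mul_add]
  abel

theorem tMul_monomial (i : ℕ) (a : D) :
    tMul δ (monomial i a) = monomial (i + 1) a + monomial i (δ a) := by
  rw [tMul_apply, monomial_mul_X, Polynomial.sum_monomial_index]
  exact (congrArg (monomial i) (map_zero δ.toAddMonoidHom)).trans (monomial_zero_right i)

theorem lMul_monomial (i : ℕ) (a : D) : lMul δ (monomial i a) = cMul a * tMul δ ^ i := by
  change ((monomial i a).sum fun i a => cMul a * tMul δ ^ i) = _
  rw [Polynomial.sum_monomial_index]
  ext1 x; rw [end_mul, cMul_apply, Polynomial.C_0, zero_mul, end_zero]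

theorem cMul_mul (a b : D) : cMul (a * b) = cMul a * cMul b := by
  ext1 g; rw [end_mul, cMul_apply, cMul_apply, cMul_apply, Polynomial.C_mul, mul_assoc]

theorem lMul_cMul (a : D) (g : D[X]) : lMul δ (cMul a g) = cMul a * lMul δ g := by
  induction g using Polynomial.induction_on' with
  | add p q hp hq => rw [map_add, map_add, map_add, hp, hq, mul_add]
  | monomial n b =>
    rw [cMul_apply, C_mul_monomial, lMul_monomial, lMul_monomial, cMul_mul, mul_assoc]

theorem lMul_tMul (g : D[X]) : lMul δ (tMul δ g) = tMul δ * lMul δ g := by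
  induction g using Polynomial.induction_on' with
  | add p q hp hq => rw [map_add, map_add, map_add, hp, hq, mul_add]
  | monomial n b =>
    rw [tMul_monomial, map_add, lMul_monomial, lMul_monomial, lMul_monomial, ← mul_assoc,
      tMul_cMul, pow_succ', add_mul, mul_assoc]

theorem lMul_lMul (f g : D[X]) : lMul δ (lMul δ f g) = lMul δ f * lMul δ g := by
  induction f using Polynomial.induction_on' with
  | add p q hp hq =>
    rw [map_add, end_add, map_add, hp, hq, add_mul]
  | monomial n b =>
    rw [lMul_monomial]
    have h : ∀ k : ℕ, lMul δ ((tMul δ ^ k) g) = tMul δ ^ k * lMul δ g := by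
      intro k
      induction k with
      | zero => simp
      | succ k ih =>
        rw [pow_succ', mul_assoc, ← ih, ← lMul_tMul]; rfl
    rw [mul_assoc, ← h, ← lMul_cMul]; rfl

theorem tMul_pow_one (k : ℕ) : (tMul δ ^ k) 1 = X ^ k := by
  induction k with
  | zero => simp
  | succ k ih =>
    have : (tMul δ ^ (k + 1)) 1 = tMul δ ((tMul δ ^ k) 1) := by rw [pow_succ']; rfl
    rw [this, ih, X_pow_eq_monomial, tMul_monomial, δ.map_one]
    simp [X_pow_eq_monomial]

theorem lMul_apply_one (f : D[X]) : lMul δ f 1 = f := by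
  induction f using Polynomial.induction_on' with
  | add p q hp hq => rw [map_add, end_add, hp, hq]
  | monomial n b =>
    rw [lMul_monomial]
    change cMul b ((tMul δ ^ n) 1) = _
    rw [tMul_pow_one, cMul_apply, C_mul_X_pow_eq_monomial]

theorem lMul_one : lMul δ 1 = 1 := by
  have h : (1 : D[X]) = monomial 0 1 := rfl
  rw [h, lMul_monomial]
  ext1 g; rw [pow_zero, mul_one, cMul_apply, Polynomial.C_1, one_mul, end_one]

variable {δ}

instance : AddCommGroup (DiffPoly δ) := inferInstanceAs (AddCommGroup D[X])

instance : Mul (DiffPoly δ) := ⟨fun f g => lMul δ f g⟩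

instance : One (DiffPoly δ) := ⟨(1 : D[X])⟩

instance : Ring (DiffPoly δ) where
  __ := (inferInstance : AddCommGroup (DiffPoly δ))
  mul f g := f * g
  one := 1
  left_distrib f g h := map_add (lMul δ f) g h
  right_distrib f g h := congrArg (fun A : AddMonoid.End D[X] => A h) (map_add (lMul δ) f g)
  zero_mul f := congrArg (fun A : AddMonoid.End D[X] => A f) (map_zero (lMul δ))
  mul_zero f := map_zero (lMul δ f)
  mul_assoc f g h := congrArg (fun A : AddMonoid.End D[X] => A h) (lMul_lMul δ f g)
  one_mul f := congrArg (fun A : AddMonoid.End D[X] => A f) (lMul_one δ)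
  mul_one f := lMul_apply_one δ f

/-- The differential polynomial with the same coefficients as a given polynomial. -/
def ofPoly (δ : RingDer D) : D[X] ≃+ DiffPoly δ := AddEquiv.refl _

/-- The underlying polynomial. -/
def toPoly : DiffPoly δ ≃+ D[X] := AddEquiv.refl _

theorem mul_def (f g : DiffPoly δ) : f * g = ofPoly δ (lMul δ f.toPoly g.toPoly) := rfl

/-- Constant differential polynomials. -/
def C (δ : RingDer D) (a : D) : DiffPoly δ := ofPoly δ (Polynomial.C a)

/-- The indeterminate `t`. -/
def t (δ : RingDer D) : DiffPoly δ := ofPoly δ X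

/-- The defining relation `t a = a t + δ a`. -/
theorem t_mul_C (a : D) : t δ * C δ a = C δ a * t δ + C δ (δ a) := by
  change lMul δ X (Polynomial.C a) = lMul δ (Polynomial.C a) X + Polynomial.C (δ a)
  rw [← monomial_one_one_eq_X, ← monomial_zero_left, lMul_monomial, lMul_monomial]
  simp only [pow_one, pow_zero, mul_one]
  change Polynomial.C 1 * tMul δ (monomial 0 a) = Polynomial.C a * monomial 1 1 + _
  rw [tMul_monomial]
  simp [C_mul_monomial]

/-- The degree (with value `0` at `0`). -/
def natDegree (f : DiffPoly δ) : ℕ := f.toPoly.natDegree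

/-- `f` is (right) semi-invariant: for every `a ∈ D` there is `b ∈ D` with `f a = b f`. -/
def IsSemiInvariant (f : DiffPoly δ) : Prop := ∀ a : D, ∃ b : D, f * C δ a = C δ b * f

/-- `f` is two-sided (invariant): it is semi-invariant and `f t = (c t + d) f` for some
`c, d ∈ D`. -/
def IsTwoSided (f : DiffPoly δ) : Prop :=
  f.IsSemiInvariant ∧ ∃ c d : D, f * t δ = (C δ c * t δ + C δ d) * f

/-- The inclusion `C[t;δ|_C] ⊆ D[t;δ]`, where `C` is the center of `D`. -/
def ofCenter (δ : RingDer D) (f : DiffPoly δ.toCenter) : DiffPoly δ :=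
  ofPoly δ (f.toPoly.map (Subring.center D).subtype)

end ring

section division

variable {D : Type*} [DivisionRing D] {δ : RingDer D}

/-- The inclusion `F[t] ⊆ D[t;δ]`. -/
def ofConst (δ : RingDer D) (f : (δ.constField)[X]) : DiffPoly δ :=
  ofPoly δ (f.map ((Subring.center D).subtype.comp δ.constField.subtype))

theorem top_tMul_pow (g : D[X]) (N : ℕ) (hN : ∀ i, N < i → g.coeff i = 0) (k : ℕ) :
    (∀ i, N + k < i → ((tMul δ ^ k) g).coeff i = 0) ∧
      ((tMul δ ^ k) g).coeff (N + k) = g.coeff N := by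
  induction k with
  | zero => simpa using hN
  | succ k ih =>
    have : (tMul δ ^ (k + 1)) g = tMul δ ((tMul δ ^ k) g) := by rw [pow_succ']; rfl
    rw [this]
    constructor
    · intro i hi
      obtain ⟨j, rfl⟩ : ∃ j, i = j + 1 := ⟨i - 1, by omega⟩
      rw [coeff_tMul_succ, ih.1 j (by omega), ih.1 (j + 1) (by omega), map_zero, add_zero]
    · rw [← add_assoc, coeff_tMul_succ, ih.2, ih.1 _ (Nat.lt_succ_self _), map_zero, add_zero]

theorem lMul_eq_sum (q f : D[X]) :
    lMul δ q f = ∑ i ∈ q.support, Polynomial.C (q.coeff i) * (tMul δ ^ i) f := by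
  change (q.sum fun i a => cMul a * tMul δ ^ i) f = _
  rw [Polynomial.sum_def, end_sum]
  rfl

theorem coeff_lMul_top (q f : D[X]) :
    (lMul δ q f).coeff (f.natDegree + q.natDegree) = q.leadingCoeff * f.leadingCoeff := by
  have hf : ∀ i, f.natDegree < i → f.coeff i = 0 := fun i => coeff_eq_zero_of_natDegree_lt
  rw [lMul_eq_sum, finsetSum_coeff, Finset.sum_eq_single q.natDegree]
  · rw [coeff_C_mul, (top_tMul_pow f _ hf _).2]; rfl
  · intro i hi hne
    have := le_natDegree_of_mem_supp i hi
    rw [coeff_C_mul, (top_tMul_pow f _ hf i).1 _ (by omega), mul_zero]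
  · intro h
    rw [coeff_C_mul, notMem_support_iff.mp h, zero_mul]

theorem eq_zero_of_mul_mem {q f : DiffPoly δ} (hf : f ≠ 0)
    (h : (q * f).toPoly ∈ degreeLT D f.natDegree) : q = 0 := by
  by_contra hq
  rw [mem_degreeLT] at h
  have h1 : ((q * f).toPoly).coeff (f.toPoly.natDegree + q.toPoly.natDegree) = 0 := by
    apply coeff_eq_zero_of_degree_lt
    refine h.trans_le ?_
    exact_mod_cast Nat.le_add_right _ _
  have h2 := coeff_lMul_top (δ := δ) q.toPoly f.toPoly
  rw [show lMul δ q.toPoly f.toPoly = (q * f).toPoly from rfl, h1] at h2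
  rcases mul_eq_zero.mp h2.symm with h3 | h3
  · exact hq (leadingCoeff_eq_zero.mp h3)
  · exact hf (leadingCoeff_eq_zero.mp h3)

/-- Right division with remainder. -/
theorem exists_rem {f : DiffPoly δ} (hf : f ≠ 0) (g : DiffPoly δ) :
    ∃ r : D[X], r ∈ degreeLT D f.natDegree ∧ ∃ q : DiffPoly δ, g = q * f + ofPoly δ r := by
  suffices H : ∀ N : ℕ, ∀ g : D[X], g.degree < N →
      ∃ r : D[X], r ∈ degreeLT D f.natDegree ∧ ∃ q : D[X], g = lMul δ q f.toPoly + r by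
    exact H (g.toPoly.natDegree + 1) g.toPoly
      (degree_le_natDegree.trans_lt (by exact_mod_cast Nat.lt_succ_self _))
  intro N
  induction N with
  | zero =>
    intro g hg
    exact ⟨g, mem_degreeLT.mpr (hg.trans_le (by simp)), 0, by
      rw [map_zero, end_zero, zero_add]⟩
  | succ N ih =>
    intro g hg
    by_cases hN : N < f.natDegree
    · exact ⟨g, mem_degreeLT.mpr (hg.trans_le (by exact_mod_cast hN)), 0, by
        rw [map_zero, end_zero, zero_add]⟩
    · obtain ⟨k, rfl⟩ := Nat.exists_eq_add_of_le (not_lt.mp hN)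
      have hlc : f.toPoly.leadingCoeff ≠ 0 := fun h => hf (leadingCoeff_eq_zero.mp h)
      set c : D := g.coeff (f.natDegree + k) * (f.toPoly.leadingCoeff)⁻¹ with hc
      have ht := top_tMul_pow (δ := δ) f.toPoly f.natDegree
        (fun i => coeff_eq_zero_of_natDegree_lt) k
      have hmon : lMul δ (monomial k c) f.toPoly = Polynomial.C c * (tMul δ ^ k) f.toPoly := by
        rw [lMul_monomial]; rfl
      obtain ⟨r, hr, q, hq⟩ := ih (g - lMul δ (monomial k c) f.toPoly) (by
        rw [degree_lt_iff_coeff_zero]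
        intro i hi
        rw [hmon, coeff_sub, coeff_C_mul]
        rcases hi.lt_or_eq with hi | hi
        · rw [ht.1 i hi, mul_zero, sub_zero]
          rw [degree_lt_iff_coeff_zero] at hg
          exact hg i hi
        · rw [← hi, ht.2, hc, show f.toPoly.coeff f.natDegree = f.toPoly.leadingCoeff from rfl,
            mul_assoc, inv_mul_cancel₀ hlc, mul_one, sub_self])
      refine ⟨r, hr, q + monomial k c, ?_⟩
      rw [map_add, end_add, add_right_comm, ← hq, sub_add_cancel]

end division

end DiffPoly

/-- The underlying space `R_m = {g ∈ D[t;δ] : deg g < m}`, `m = deg f`, of the Petit algebra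
`S_f` (for `f = 0` it is the zero space). -/
def Petit {D : Type*} [DivisionRing D] {δ : RingDer D} (f : DiffPoly δ) : Type _ :=
  degreeLT D f.natDegree

namespace Petit

variable {D : Type*} [DivisionRing D] {δ : RingDer D} {f : DiffPoly δ}

instance : AddCommGroup (Petit f) := inferInstanceAs (AddCommGroup (degreeLT D f.natDegree))

/-- Scalars act on the coefficients from the left. -/
instance {S : Type*} [Semiring S] [Module S D] [IsScalarTower S D D] : Module S (Petit f) :=
  inferInstanceAs (Module S (degreeLT D f.natDegree))

/-- A polynomial of degree less than `deg f`, as an element of `R_m`. -/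
def mk (r : D[X]) (hr : r ∈ degreeLT D f.natDegree) : Petit f := ⟨r, hr⟩

/-- The inclusion of `R_m` into `D[t;δ]`. -/
def val : Petit f →+ DiffPoly δ := (degreeLT D f.natDegree).subtype.toAddMonoidHom

theorem val_injective : Function.Injective (val : Petit f → DiffPoly δ) :=
  Subtype.val_injective

/-- The remainder `g mod_r f` of right division of `g` by `f`: `g = q f + (g mod_r f)` for some
`q`, with `deg (g mod_r f) < deg f` (with value `0` for `f = 0`). -/
def modr (f g : DiffPoly δ) : Petit f :=
  open Classical in
  if hf : f = 0 then 0 else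
    mk (Classical.choose (DiffPoly.exists_rem hf g))
      (Classical.choose_spec (DiffPoly.exists_rem hf g)).1

theorem modr_spec (hf : f ≠ 0) (g : DiffPoly δ) : ∃ q, g = q * f + val (modr f g) := by
  rw [modr, dif_neg hf]
  exact (Classical.choose_spec (DiffPoly.exists_rem hf g)).2

theorem modr_unique (hf : f ≠ 0) {g q : DiffPoly δ} {r : Petit f} (h : g = q * f + val r) :
    modr f g = r := by
  obtain ⟨q', hq'⟩ := modr_spec hf g
  have h1 : (q' - q) * f = val (r - modr f g) := by
    rw [sub_mul, map_sub, sub_eq_sub_iff_add_eq_add, ← hq', h, add_comm]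
  have h2 : q' - q = 0 := DiffPoly.eq_zero_of_mul_mem hf (by
    rw [h1]; exact (r - modr f g).2)
  rw [h2, zero_mul] at h1
  have h3 : r - modr f g = 0 := val_injective (by rw [← h1, map_zero])
  exact (sub_eq_zero.mp h3).symm

theorem subsingleton_of_natDegree (hf : f.natDegree = 0) : Subsingleton (Petit f) := by
  refine ⟨fun a b => Subtype.ext ?_⟩
  have h : ∀ x : Petit f, x.1 = 0 := by
    intro x
    have h1 : (x.1 : D[X]).degree < ((0 : ℕ) : WithBot ℕ) :=
      (mem_degreeLT.mp x.2).trans_eq (congrArg _ hf)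
    exact degree_eq_bot.mp (Nat.WithBot.lt_zero_iff.mp (by exact_mod_cast h1))
  exact (h a).trans (h b).symm

theorem modr_zero_left (hf : f = 0) (g : DiffPoly δ) : modr f g = 0 := by
  rw [modr, dif_pos hf]

theorem modr_add (g h : DiffPoly δ) : modr f (g + h) = modr f g + modr f h := by
  by_cases hf : f = 0
  · simp [modr_zero_left hf]
  · obtain ⟨q, hq⟩ := modr_spec hf g
    obtain ⟨q', hq'⟩ := modr_spec hf h
    refine modr_unique hf (q := q + q') ?_
    rw [add_mul, map_add]
    nth_rewrite 1 [hq, hq']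
    abel

theorem modr_val (x : Petit f) : modr f (val x) = x := by
  by_cases hf : f = 0
  · have : Subsingleton (Petit f) := subsingleton_of_natDegree (by rw [hf]; exact natDegree_zero)
    exact Subsingleton.elim _ _
  · exact modr_unique hf (q := 0) (by rw [zero_mul, zero_add])

theorem modr_zero : modr f 0 = 0 := by
  have h := modr_val (0 : Petit f)
  rwa [map_zero] at h

theorem val_modr_one (hf : f.natDegree ≠ 0) : val (modr f 1) = 1 := by
  have h : (1 : D[X]) ∈ degreeLT D f.natDegree := by
    rw [mem_degreeLT, degree_one]
    exact_mod_cast Nat.pos_of_ne_zero hf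
  have := modr_val (⟨1, h⟩ : Petit f)
  exact congrArg val this

/-- The Petit algebra `S_f`: the space `R_m` with the product `g ∘ h = g h mod_r f`. Its unit is
the remainder of `1`, which is the constant polynomial `1` when `deg f > 0`. -/
instance : NonAssocRing (Petit f) where
  __ := (inferInstance : AddCommGroup (Petit f))
  mul x y := modr f (val x * val y)
  one := modr f 1
  left_distrib x y z := by
    change modr f (val x * val (y + z)) = modr f (val x * val y) + modr f (val x * val z)
    rw [map_add, mul_add, modr_add]
  right_distrib x y z := by
    change modr f (val (x + y) * val z) = modr f (val x * val z) + modr f (val y * val z)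
    rw [map_add, add_mul, modr_add]
  zero_mul x := by
    change modr f (val 0 * val x) = 0
    rw [map_zero, zero_mul, modr_zero]
  mul_zero x := by
    change modr f (val x * val 0) = 0
    rw [map_zero, mul_zero, modr_zero]
  one_mul x := by
    change modr f (val (modr f 1) * val x) = x
    by_cases hf : f.natDegree = 0
    · have := subsingleton_of_natDegree hf
      exact Subsingleton.elim _ _
    · rw [val_modr_one hf, one_mul, modr_val]
  mul_one x := by
    change modr f (val x * val (modr f 1)) = x
    by_cases hf : f.natDegree = 0
    · have := subsingleton_of_natDegree hf
      exact Subsingleton.elim _ _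
    · rw [val_modr_one hf, mul_one, modr_val]

theorem mul_def (x y : Petit f) : x * y = modr f (val x * val y) := rfl

/-- The copy of `D` in `S_f`: the constant polynomials of degree less than `deg f`. -/
def constants (f : DiffPoly δ) : Set (Petit f) := {x | ∃ a : D, val x = DiffPoly.C δ a}

end Petit

/-- The left nucleus of a nonassociative ring. -/
def leftNucleus (A : Type*) [NonUnitalNonAssocRing A] : Set A :=
  {x | ∀ y z : A, associator x y z = 0}

/-- The middle nucleus of a nonassociative ring. -/
def middleNucleus (A : Type*) [NonUnitalNonAssocRing A] : Set A :=
  {x | ∀ y z : A, associator y x z = 0}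

/-- The right nucleus of a nonassociative ring. -/
def rightNucleus (A : Type*) [NonUnitalNonAssocRing A] : Set A :=
  {x | ∀ y z : A, associator y z x = 0}

/-- A nonassociative algebra `A ≠ 0` is a division algebra if left and right multiplication by
every nonzero element is bijective. -/
def IsNonassocDivision (A : Type*) [NonUnitalNonAssocRing A] : Prop :=
  Nontrivial A ∧ ∀ a : A, a ≠ 0 →
    Function.Bijective (fun x : A => a * x) ∧ Function.Bijective (fun x : A => x * a)

end

/-! Everything rests on right division by `f` in R = D[t;δ] and on additivity of degrees there.

Dimension. S_f is a left D-space of dimension m, so dim_F S_f = m · n² · [C:F], and it must be shown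
that [C:F] is the degree N of the minimum polynomial of δ|_C. Elements of C independent over the
constants F have independent Wronskian columns, and N rows suffice because δ^N is an F-combination
of lower powers; hence [C:F] ≤ N. Conversely the minimum polynomial divides the characteristic
polynomial, whose degree is [C:F].

Nuclei. If xy = qf + r, then (x∘y)∘z − x∘(y∘z) is the remainder of −qfz, so the associator vanishes
exactly when qfz ∈ Rf (`associator_eq_zero_iff`). If x or y is constant, then deg xy < m and q = 0.
If deg xy = m, then q is a nonzero constant and the condition becomes fz ∈ Rf; testing it on
constants z gives semi-invariance, and on z = t two-sidedness.

Division. For `f` irreducible, let x∘a = 0 with x, a nonzero. The left ideal {h : ha ∈ Rf} is Rg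
with deg g < m, yet h ↦ ha maps R/Rg onto R/Rf, because Ra + Rf = R; comparing dimensions over D
gives a contradiction. Finite dimension over F then turns injectivity of the multiplications into
bijectivity.

Subalgebras. Division with remainder over F or over C is also division over D, so by uniqueness
remainders are compatible with the inclusions of F[t] and C[t;δ]. -/

/-! ### Wronskians and the degree of a field over its constants -/

section Wronskian

variable {F K : Type*} [Field F] [Field K] [Algebra F K]

/-- The Wronskian argument: scale a relation so that one coefficient is 1, differentiate it and
subtract the relation for the next power of `d`. The result is a shorter relation among the
derivatives of the coefficients, so by induction these vanish. The coefficients are then constants,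
against independence over `F`. -/
theorem eq_zero_of_sum_mul_iterate_derivation {d : K →ₗ[F] K}
    (hd : ∀ a b, d (a * b) = a * d b + d a * b)
    (hconst : ∀ a, d a = 0 → ∃ b : F, algebraMap F K b = a)
    {ι : Type*} {v : ι → K} (hv : LinearIndependent F v) (s : Finset ι) :
    ∀ c : ι → K, (∀ i : ℕ, ∑ j ∈ s, c j * (d ^ i) (v j) = 0) → ∀ j ∈ s, c j = 0 := by
  classical
  induction s using Finset.induction_on with
  | empty => simp
  | insert a s ha ih =>
    intro c hc
    suffices h : c a = 0 by
      have h2 := ih c (fun i => by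
        have := hc i
        rwa [Finset.sum_insert ha, h, zero_mul, zero_add] at this)
      intro j hj
      rcases Finset.mem_insert.mp hj with rfl | hj
      exacts [h, h2 j hj]
    by_contra h0
    have hd1 : d 1 = 0 := by simpa using hd 1 1
    have hc' : ∀ i : ℕ, ∑ j ∈ insert a s, ((c a)⁻¹ * c j) * (d ^ i) (v j) = 0 := by
      intro i
      simp only [mul_assoc, ← Finset.mul_sum, hc i, mul_zero]
    have hder : ∀ j ∈ s, d ((c a)⁻¹ * c j) = 0 := by
      refine ih (fun j => d ((c a)⁻¹ * c j)) fun i => ?_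
      have h1 := congrArg d (hc' i)
      rw [map_zero, map_sum] at h1
      rw [Finset.sum_congr rfl fun j _ => hd ((c a)⁻¹ * c j) _, Finset.sum_add_distrib] at h1
      -- Differentiating relation `i` gives relation `i + 1` plus the sum with differentiated
      -- coefficients; in the latter the term at `a` drops out because d(1) = 0.
      have h2 := hc' (i + 1)
      simp only [pow_succ', Module.End.mul_apply] at h2
      rw [h2, zero_add, Finset.sum_insert ha, inv_mul_cancel₀ h0, hd1, zero_mul, zero_add] at h1
      exact h1
    have hder' : ∀ j ∈ insert a s, d ((c a)⁻¹ * c j) = 0 := by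
      intro j hj
      rcases Finset.mem_insert.mp hj with rfl | hj
      · rw [inv_mul_cancel₀ h0, hd1]
      · exact hder j hj
    choose! b hb using fun j hj => hconst _ (hder' j hj)
    have h1 : ∑ j ∈ insert a s, b j • v j = 0 := by
      have := hc' 0
      simp only [pow_zero, Module.End.one_apply] at this
      rw [← this]
      exact Finset.sum_congr rfl fun j hj => by rw [Algebra.smul_def, hb j hj]
    have h2 := linearIndependent_iff'.mp hv _ b h1 a (Finset.mem_insert_self a s)
    have h3 := hb a (Finset.mem_insert_self a s)
    rw [h2, map_zero, inv_mul_cancel₀ h0] at h3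
    exact zero_ne_one h3

/-- The truncated Wronskian columns lie in K^N, so their independence over `K` bounds their number.
-/
theorem card_le_natDegree_minpoly_derivation {d : K →ₗ[F] K}
    (hd : ∀ a b, d (a * b) = a * d b + d a * b)
    (hconst : ∀ a, d a = 0 → ∃ b : F, algebraMap F K b = a)
    (hint : IsIntegral F d) {ι : Type*} [Fintype ι] {v : ι → K} (hv : LinearIndependent F v) :
    Fintype.card ι ≤ (minpoly F d).natDegree := by
  set N := (minpoly F d).natDegree with hN
  have hli : LinearIndependent K (fun j (i : Fin N) => (d ^ (i : ℕ)) (v j)) := by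
    rw [Fintype.linearIndependent_iff]
    intro c hc j
    refine eq_zero_of_sum_mul_iterate_derivation hd hconst hv Finset.univ c ?_ j
      (Finset.mem_univ j)
    have hlow : ∀ i < N, ∑ j, c j * (d ^ i) (v j) = 0 := by
      intro i hi
      have := congrFun hc ⟨i, hi⟩
      simpa using this
    intro i
    -- Reducing X^i modulo the minimal polynomial expresses every power of `d` through those below
    -- `N`, so the first `N` relations imply all others.
    have hdi : d ^ i = aeval d ((X ^ i : F[X]) %ₘ minpoly F d) := by
      rw [aeval_modByMonic_eq_self_of_root (minpoly.aeval F d), map_pow, aeval_X]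
    have hdeg : ((X ^ i : F[X]) %ₘ minpoly F d).degree < N := by
      rw [hN, ← degree_eq_natDegree (minpoly.ne_zero hint)]
      exact degree_modByMonic_lt _ (minpoly.monic hint)
    rw [hdi, aeval_eq_sum_range]
    simp only [LinearMap.sum_apply, LinearMap.smul_apply, Finset.mul_sum]
    rw [Finset.sum_comm]
    refine Finset.sum_eq_zero fun k _ => ?_
    simp only [mul_smul_comm, ← Finset.smul_sum]
    by_cases hk : k < N
    · rw [hlow k hk, smul_zero]
    · rw [coeff_eq_zero_of_degree_lt (hdeg.trans_le (by exact_mod_cast not_lt.mp hk)), zero_smul]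
  simpa using hli.fintype_card_le_finrank

/-- A field with a derivation that is algebraic over the constants has as its dimension over the
constants the degree of the minimal polynomial. -/
theorem finrank_eq_natDegree_minpoly_derivation {d : K →ₗ[F] K}
    (hd : ∀ a b, d (a * b) = a * d b + d a * b)
    (hconst : ∀ a, d a = 0 → ∃ b : F, algebraMap F K b = a)
    (hint : IsIntegral F d) :
    FiniteDimensional F K ∧ Module.finrank F K = (minpoly F d).natDegree := by
  have hrank : Module.rank F K ≤ (minpoly F d).natDegree :=
    rank_le fun s hs => by
      simpa using card_le_natDegree_minpoly_derivation hd hconst hint hs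
  have hfin : FiniteDimensional F K :=
    Module.rank_lt_aleph0_iff.mp (hrank.trans_lt (Cardinal.natCast_lt_aleph0))
  refine ⟨hfin, le_antisymm (Module.finrank_le_of_rank_le hrank) ?_⟩
  -- The lower bound: the characteristic polynomial has degree [K:F] and is a multiple of the
  -- minimal polynomial.
  rw [← LinearMap.charpoly_natDegree d]
  exact natDegree_le_of_dvd (LinearMap.minpoly_dvd_charpoly d) (LinearMap.charpoly_monic d).ne_zero

end Wronskian

namespace RingDer

variable {D : Type*} [DivisionRing D] (δ : RingDer D)

theorem finrank_center (hδ : IsAlgebraic δ.constField δ.centerLin) :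
    FiniteDimensional δ.constField (Subring.center D) ∧
      Module.finrank δ.constField (Subring.center D) =
        (minpoly δ.constField δ.centerLin).natDegree :=
  finrank_eq_natDegree_minpoly_derivation (d := δ.centerLin) δ.toCenter.leibniz
    (fun a ha => ⟨⟨a, congrArg Subtype.val ha⟩, rfl⟩) hδ.isIntegral

end RingDer

/-! ### Degrees and coefficients in D[t;δ] -/

namespace DiffPoly

section ring

variable {D : Type*} [Ring D] {δ : RingDer D}

theorem C_mul_eq (a : D) (g : DiffPoly δ) :
    (C δ a * g).toPoly = Polynomial.C a * g.toPoly := by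
  change lMul δ (Polynomial.C a) g.toPoly = _
  rw [← monomial_zero_left, lMul_monomial, pow_zero, mul_one, cMul_apply, monomial_zero_left]

theorem toPoly_t_mul (g : DiffPoly δ) : (t δ * g).toPoly = tMul δ g.toPoly := by
  change lMul δ X g.toPoly = _
  rw [← monomial_one_one_eq_X, lMul_monomial, pow_one, end_mul, cMul_apply, Polynomial.C_1,
    one_mul]

theorem toPoly_t_pow (k : ℕ) : (t δ ^ k).toPoly = X ^ k := by
  induction k with
  | zero => rfl
  | succ k ih =>
    rw [pow_succ', toPoly_t_mul, ih, ← tMul_pow_one δ, ← tMul_pow_one δ, pow_succ']; rfl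

theorem C_one : C δ (1 : D) = 1 := rfl

theorem C_mul (a b : D) : C δ (a * b) = C δ a * C δ b := by
  apply toPoly.injective
  rw [C_mul_eq]
  exact Polynomial.C_mul

/-- Every differential polynomial is a left combination of powers of `t`. -/
@[elab_as_elim]
theorem induction_on {P : DiffPoly δ → Prop} (g : DiffPoly δ)
    (hadd : ∀ g h, P g → P h → P (g + h)) (ht : ∀ a k, P (C δ a * t δ ^ k)) : P g := by
  have H : ∀ q : D[X], P (ofPoly δ q) := by
    intro q
    induction q using Polynomial.induction_on' with
    | add q r hq hr => exact hadd _ _ hq hr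
    | monomial k a =>
      have : ofPoly δ (monomial k a) = C δ a * t δ ^ k := by
        apply toPoly.injective
        rw [C_mul_eq, toPoly_t_pow, C_mul_X_pow_eq_monomial]; rfl
      rw [this]; exact ht a k
  exact H g

end ring

section division

variable {D : Type*} [DivisionRing D] {δ : RingDer D}

theorem mul_ne_zero' {q f : DiffPoly δ} (hq : q ≠ 0) (hf : f ≠ 0) : q * f ≠ 0 := by
  intro h
  refine hq (eq_zero_of_mul_mem hf ?_)
  rw [h]
  exact Submodule.zero_mem _

instance : NoZeroDivisors (DiffPoly δ) where
  eq_zero_or_eq_zero_of_mul_eq_zero h := by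
    by_contra! H
    exact mul_ne_zero' H.1 H.2 h

instance : Nontrivial (DiffPoly δ) := inferInstanceAs (Nontrivial D[X])

/-- Moving t past a coefficient only adds terms of lower degree, so leading coefficients multiply as
in an ordinary polynomial ring, and `D` has no zero divisors. -/
theorem natDegree_mul {q f : DiffPoly δ} (hq : q ≠ 0) (hf : f ≠ 0) :
    (q * f).natDegree = q.natDegree + f.natDegree := by
  have h2 := coeff_lMul_top (δ := δ) q.toPoly f.toPoly
  apply le_antisymm
  · refine natDegree_le_iff_coeff_eq_zero.mpr fun i hi => ?_
    change (lMul δ q.toPoly f.toPoly).coeff i = 0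
    rw [lMul_eq_sum, finsetSum_coeff]
    refine Finset.sum_eq_zero fun j hj => ?_
    have hj' : j ≤ q.natDegree := le_natDegree_of_mem_supp j hj
    rw [coeff_C_mul, (top_tMul_pow f.toPoly f.natDegree
      (fun k => coeff_eq_zero_of_natDegree_lt) j).1 i (by omega), mul_zero]
  · rw [add_comm]
    refine le_natDegree_of_ne_zero ?_
    refine (ne_of_eq_of_ne h2 ?_)
    exact mul_ne_zero (leadingCoeff_ne_zero.mpr hq) (leadingCoeff_ne_zero.mpr hf)

theorem natDegree_t_pow (k : ℕ) : (t δ ^ k).natDegree = k := by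
  change (t δ ^ k).toPoly.natDegree = k
  rw [toPoly_t_pow, natDegree_X_pow]

theorem natDegree_C (a : D) : (C δ a).natDegree = 0 := Polynomial.natDegree_C a

theorem exists_eq_C {g : DiffPoly δ} (hg : g.natDegree = 0) : ∃ a, g = C δ a :=
  ⟨_, eq_C_of_natDegree_eq_zero hg⟩

theorem C_ne_zero {a : D} : C δ a ≠ 0 ↔ a ≠ 0 := Polynomial.C_ne_zero

theorem mem_degreeLT_iff {g : DiffPoly δ} {k : ℕ} (hk : 0 < k) :
    g.toPoly ∈ degreeLT D k ↔ g.natDegree < k := by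
  rw [mem_degreeLT]
  change _ ↔ g.toPoly.natDegree < k
  by_cases hg : g.toPoly = 0
  · simp [hg, hk]
  · exact (natDegree_lt_iff_degree_lt hg).symm

theorem t_ne_zero : t δ ≠ 0 := X_ne_zero

theorem natDegree_eq_zero_of_isUnit {u : DiffPoly δ} (hu : IsUnit u) : u.natDegree = 0 := by
  obtain ⟨v, hv⟩ := hu.exists_right_inv
  have h0 : u ≠ 0 := hu.ne_zero
  have h1 : v ≠ 0 := by rintro rfl; simp at hv
  have := natDegree_mul h0 h1
  rw [hv, ← C_one, natDegree_C] at this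
  omega

end division

end DiffPoly

/-! ### Dimension, remainders and nuclei of the Petit algebra -/

namespace Petit

section modules

variable {D : Type*} [DivisionRing D] {δ : RingDer D}

theorem finrank_eq (S : Type*) [Field S] [Module S D] [IsScalarTower S D D]
    [FiniteDimensional S D] (f : DiffPoly δ) :
    Module.finrank S (Petit f) = f.natDegree * Module.finrank S D := by
  let e : Petit f ≃ₗ[S] (Fin f.natDegree → D) :=
    (degreeLTEquiv D f.natDegree).restrictScalars S
  rw [e.finrank_eq, Module.finrank_pi_fintype, Finset.sum_const, Finset.card_univ, Fintype.card_fin,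
    smul_eq_mul]

theorem finiteDimensional (S : Type*) [Field S] [Module S D] [IsScalarTower S D D]
    [FiniteDimensional S D] (f : DiffPoly δ) : FiniteDimensional S (Petit f) :=
  let e : Petit f ≃ₗ[S] (Fin f.natDegree → D) :=
    (degreeLTEquiv D f.natDegree).restrictScalars S
  Module.Finite.equiv e.symm

end modules

variable {D : Type*} [DivisionRing D] {δ : RingDer D} {f : DiffPoly δ}

theorem natDegree_val_lt (hf : f.natDegree ≠ 0) (x : Petit f) :
    (val x).natDegree < f.natDegree :=
  (DiffPoly.mem_degreeLT_iff (Nat.pos_of_ne_zero hf)).mp x.2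

theorem exists_val_eq {g : DiffPoly δ} (hg : g.natDegree < f.natDegree) :
    ∃ x : Petit f, val x = g :=
  ⟨⟨g.toPoly, (DiffPoly.mem_degreeLT_iff (by omega)).mpr hg⟩, rfl⟩

theorem modr_eq_modr_iff (hf : f ≠ 0) {g h : DiffPoly δ} :
    modr f g = modr f h ↔ ∃ q, g - h = q * f := by
  constructor
  · intro H
    obtain ⟨q, hq⟩ := modr_spec hf g
    obtain ⟨q', hq'⟩ := modr_spec hf h
    refine ⟨q - q', ?_⟩
    rw [sub_mul, sub_eq_sub_iff_add_eq_add]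
    nth_rewrite 1 [hq, hq']
    rw [H]; abel
  · rintro ⟨q, hq⟩
    obtain ⟨q', hq'⟩ := modr_spec hf h
    refine modr_unique hf (q := q + q') ?_
    rw [add_mul, add_assoc, ← hq', ← hq, sub_add_cancel]

theorem modr_eq_zero_iff (hf : f ≠ 0) {g : DiffPoly δ} : modr f g = 0 ↔ ∃ q, g = q * f := by
  rw [← modr_zero, modr_eq_modr_iff hf, sub_zero]

/-- Rf is a left ideal, so the right factor may be reduced first. For the left factor this fails in
general, which is where nonassociativity comes from. -/
theorem modr_mul_modr (g h : DiffPoly δ) : modr f (g * val (modr f h)) = modr f (g * h) := by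
  by_cases hf : f = 0
  · rw [modr_zero_left hf, modr_zero_left hf]
  obtain ⟨q, hq⟩ := modr_spec hf h
  refine (modr_eq_modr_iff hf).mpr ⟨-(g * q), ?_⟩
  nth_rewrite 2 [hq]
  noncomm_ring

theorem associator_eq_zero_iff (hf : f ≠ 0) {x y z r : Petit f} {q : DiffPoly δ}
    (h : val x * val y = q * f + val r) :
    associator x y z = 0 ↔ ∃ s, q * f * val z = s * f := by
  have hxy : x * y = r := modr_unique hf h
  rw [associator_apply, hxy, sub_eq_zero, mul_def r z, mul_def x, mul_def y, modr_mul_modr,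
    modr_eq_modr_iff hf, ← mul_assoc, h]
  constructor
  · rintro ⟨s, hs⟩
    refine ⟨-s, ?_⟩
    rw [neg_mul, ← hs]; noncomm_ring
  · rintro ⟨s, hs⟩
    refine ⟨-s, ?_⟩
    rw [neg_mul, ← hs]; noncomm_ring

theorem associator_eq_zero_of_natDegree_lt {x y : Petit f}
    (h : (val x * val y).natDegree < f.natDegree) (z : Petit f) : associator x y z = 0 := by
  obtain ⟨r, hr⟩ := exists_val_eq h
  have hf : f ≠ 0 := by rintro rfl; exact absurd h (Nat.not_lt_zero _)
  exact (associator_eq_zero_iff hf (q := 0) (by rw [zero_mul, zero_add, hr])).mpr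
    ⟨0, by rw [zero_mul, zero_mul]⟩

/-- When the product has degree exactly m, the quotient by `f` is a nonzero constant, which can be
cancelled from qfz ∈ Rf. -/
theorem exists_mul_val_eq_of_associator {x y z : Petit f}
    (h : (val x * val y).natDegree = f.natDegree) (hf : f.natDegree ≠ 0)
    (hz : associator x y z = 0) : ∃ s, f * val z = s * f := by
  have hf0 : f ≠ 0 := by rintro rfl; exact hf natDegree_zero
  obtain ⟨q, hq⟩ := modr_spec hf0 (val x * val y)
  have hr := natDegree_val_lt hf (modr f (val x * val y))
  have hq0 : q ≠ 0 := by
    rintro rfl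
    rw [zero_mul, zero_add] at hq
    rw [← hq, h] at hr
    exact lt_irrefl _ hr
  have hdeg : (q * f).natDegree ≤ f.natDegree := by
    rw [← sub_eq_iff_eq_add] at hq
    rw [← hq]
    exact (natDegree_sub_le _ _).trans (max_le h.le hr.le)
  rw [DiffPoly.natDegree_mul hq0 hf0] at hdeg
  obtain ⟨a, rfl⟩ := DiffPoly.exists_eq_C (show q.natDegree = 0 by omega)
  obtain ⟨s, hs⟩ := (associator_eq_zero_iff hf0 hq).mp hz
  refine ⟨DiffPoly.C δ a⁻¹ * s, ?_⟩
  rw [mul_assoc, ← hs, ← mul_assoc, ← mul_assoc, ← DiffPoly.C_mul,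
    inv_mul_cancel₀ (DiffPoly.C_ne_zero.mp hq0), DiffPoly.C_one, one_mul]

theorem isSemiInvariant_of_forall (hf : 1 ≤ f.natDegree)
    (h : ∀ z : Petit f, val z ∈ Set.range (DiffPoly.C δ) → ∃ s, f * val z = s * f) :
    f.IsSemiInvariant := by
  have hf0 : f ≠ 0 := by rintro rfl; exact absurd hf (Nat.not_succ_le_zero _)
  intro a
  -- Zero is separated because the degree comparison below needs nonzero factors; it forces `s` to
  -- be constant.
  by_cases ha : a = 0
  · subst ha
    refine ⟨0, ?_⟩
    rw [show DiffPoly.C δ (0 : D) = 0 from Polynomial.C_0, mul_zero, zero_mul]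
  obtain ⟨x, hx⟩ := exists_val_eq (f := f) (g := DiffPoly.C δ a)
    (by rw [DiffPoly.natDegree_C]; omega)
  obtain ⟨s, hs⟩ := h x ⟨a, hx.symm⟩
  rw [hx] at hs
  have hC := DiffPoly.C_ne_zero (δ := δ).mpr ha
  have hs0 : s ≠ 0 := by
    rintro rfl
    rw [zero_mul] at hs
    exact mul_ne_zero hf0 hC hs
  have h2 := congrArg DiffPoly.natDegree hs
  rw [DiffPoly.natDegree_mul hf0 hC, DiffPoly.natDegree_mul hs0 hf0, DiffPoly.natDegree_C] at h2
  obtain ⟨b, rfl⟩ := DiffPoly.exists_eq_C (show s.natDegree = 0 by omega)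
  exact ⟨b, hs⟩

theorem isTwoSided_of_forall (hf : 2 ≤ f.natDegree)
    (h : ∀ z : Petit f, ∃ s, f * val z = s * f) : f.IsTwoSided := by
  have hf0 : f ≠ 0 := by rintro rfl; exact absurd hf (Nat.not_succ_le_zero _)
  refine ⟨isSemiInvariant_of_forall (by omega) fun z _ => h z, ?_⟩
  have ht : (DiffPoly.t δ).natDegree = 1 := natDegree_X
  have ht0 : DiffPoly.t δ ≠ 0 := DiffPoly.t_ne_zero
  obtain ⟨x, hx⟩ := exists_val_eq (f := f) (g := DiffPoly.t δ) (by omega)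
  obtain ⟨s, hs⟩ := h x
  rw [hx] at hs
  have hs0 : s ≠ 0 := by
    rintro rfl
    rw [zero_mul] at hs
    exact mul_ne_zero hf0 ht0 hs
  have h2 := congrArg DiffPoly.natDegree hs
  rw [DiffPoly.natDegree_mul hf0 ht0, DiffPoly.natDegree_mul hs0 hf0, ht] at h2
  -- Comparing degrees in f t = s f shows that `s` has degree 1.
  refine ⟨s.toPoly.coeff 1, s.toPoly.coeff 0, ?_⟩
  rw [hs]
  congr 1
  apply DiffPoly.toPoly.injective
  rw [map_add, DiffPoly.C_mul_eq]
  exact eq_X_add_C_of_natDegree_le_one (show s.natDegree ≤ 1 by omega)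

theorem natDegree_val_eq_zero_iff {x : Petit f} :
    (val x).natDegree = 0 ↔ x ∈ constants f :=
  ⟨DiffPoly.exists_eq_C, fun ⟨a, ha⟩ => by rw [ha, DiffPoly.natDegree_C]⟩

theorem natDegree_mul_val_lt_of_mem_constants {x y : Petit f} (hf : f.natDegree ≠ 0)
    (h : x ∈ constants f ∨ y ∈ constants f) : (val x * val y).natDegree < f.natDegree := by
  by_cases hx : val x = 0
  · rw [hx, zero_mul]; exact Nat.pos_of_ne_zero hf
  by_cases hy : val y = 0
  · rw [hy, mul_zero]; exact Nat.pos_of_ne_zero hf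
  have h1 := natDegree_val_lt hf x
  have h2 := natDegree_val_lt hf y
  rw [DiffPoly.natDegree_mul hx hy]
  rcases h with h | h <;> have h3 := natDegree_val_eq_zero_iff.mpr h <;> omega

theorem leftNucleus_eq (hf : 2 ≤ f.natDegree) (h : ¬ f.IsTwoSided) :
    leftNucleus (Petit f) = constants f := by
  ext x
  constructor
  · intro hx
    by_contra hx0
    rw [← natDegree_val_eq_zero_iff] at hx0
    have hx1 : val x ≠ 0 := fun h0 => hx0 (by rw [h0]; exact natDegree_zero)
    refine h (isTwoSided_of_forall hf fun z => ?_)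
    have hlt := natDegree_val_lt (by omega) x
    have hdeg := DiffPoly.natDegree_t_pow (δ := δ) (f.natDegree - (val x).natDegree)
    -- This power of t brings the product to degree exactly m; it lies in R_m because `x` is not
    -- constant.
    obtain ⟨y, hy⟩ := exists_val_eq (f := f)
      (g := DiffPoly.t δ ^ (f.natDegree - (val x).natDegree)) (by omega)
    refine exists_mul_val_eq_of_associator (x := x) (y := y) ?_ (by omega) (hx y z)
    rw [hy, DiffPoly.natDegree_mul hx1
      (pow_ne_zero _ DiffPoly.t_ne_zero), hdeg]
    omega
  · intro hx y z
    exact associator_eq_zero_of_natDegree_lt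
      (natDegree_mul_val_lt_of_mem_constants (by omega) (Or.inl hx)) z

theorem middleNucleus_eq (hf : 2 ≤ f.natDegree) (h : ¬ f.IsTwoSided) :
    middleNucleus (Petit f) = constants f := by
  ext x
  constructor
  · intro hx
    by_contra hx0
    rw [← natDegree_val_eq_zero_iff] at hx0
    have hx1 : val x ≠ 0 := fun h0 => hx0 (by rw [h0]; exact natDegree_zero)
    refine h (isTwoSided_of_forall hf fun z => ?_)
    have hlt := natDegree_val_lt (by omega) x
    have hdeg := DiffPoly.natDegree_t_pow (δ := δ) (f.natDegree - (val x).natDegree)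
    obtain ⟨y, hy⟩ := exists_val_eq (f := f)
      (g := DiffPoly.t δ ^ (f.natDegree - (val x).natDegree)) (by omega)
    refine exists_mul_val_eq_of_associator (x := y) (y := x) ?_ (by omega) (hx y z)
    rw [hy, DiffPoly.natDegree_mul (pow_ne_zero _ DiffPoly.t_ne_zero) hx1, hdeg]
    omega
  · intro hx y z
    exact associator_eq_zero_of_natDegree_lt
      (natDegree_mul_val_lt_of_mem_constants (by omega) (Or.inr hx)) z

theorem mem_rightNucleus_of_mul_eq (hf : f ≠ 0) {z : Petit f} {s : DiffPoly δ}
    (h : f * val z = s * f) : z ∈ rightNucleus (Petit f) := by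
  intro x y
  obtain ⟨q, hq⟩ := modr_spec hf (val x * val y)
  exact (associator_eq_zero_iff hf hq).mpr ⟨q * s, by rw [mul_assoc, h, mul_assoc]⟩

theorem constants_subset_rightNucleus_iff (hf : 2 ≤ f.natDegree) :
    constants f ⊆ rightNucleus (Petit f) ↔ f.IsSemiInvariant := by
  have hf0 : f ≠ 0 := by rintro rfl; exact absurd hf (Nat.not_succ_le_zero _)
  constructor
  · intro h
    refine isSemiInvariant_of_forall (by omega) fun z ⟨a, ha⟩ => ?_
    have hdeg := DiffPoly.natDegree_t_pow (δ := δ)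
    -- The pair t^(m−1), t has product of degree exactly m; both lie in R_m since m ≥ 2.
    obtain ⟨x, hx⟩ := exists_val_eq (f := f) (g := DiffPoly.t δ ^ (f.natDegree - 1))
      (by rw [hdeg]; omega)
    obtain ⟨y, hy⟩ := exists_val_eq (f := f) (g := DiffPoly.t δ ^ 1) (by rw [hdeg]; omega)
    refine exists_mul_val_eq_of_associator (x := x) (y := y) ?_ (by omega) (h ⟨a, ha.symm⟩ x y)
    rw [hx, hy, ← pow_add, hdeg]
    omega
  · rintro h z ⟨a, ha⟩
    obtain ⟨b, hb⟩ := h a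
    exact mem_rightNucleus_of_mul_eq hf0 (ha ▸ hb)

end Petit

/-! ### Left ideals and Bézout identities -/

namespace DiffPoly

variable {D : Type*} [DivisionRing D] {δ : RingDer D}

/-- A nonzero element of least degree in a left ideal divides all its elements on the right. -/
theorem exists_generator (I : Submodule (DiffPoly δ) (DiffPoly δ)) (hI : I ≠ ⊥) :
    ∃ g ∈ I, g ≠ 0 ∧ ∀ h ∈ I, ∃ q, h = q * g := by
  classical
  obtain ⟨g₀, hg₀, hg₀0⟩ := Submodule.exists_mem_ne_zero_of_ne_bot hI
  have hex : ∃ k, ∃ g ∈ I, g ≠ 0 ∧ g.natDegree = k := ⟨_, g₀, hg₀, hg₀0, rfl⟩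
  obtain ⟨g, hg, hg0, hdeg⟩ := Nat.find_spec hex
  refine ⟨g, hg, hg0, fun h hh => ?_⟩
  obtain ⟨r, hr, q, hq⟩ := exists_rem hg0 h
  refine ⟨q, ?_⟩
  suffices r = 0 by rw [hq, this, map_zero, add_zero]
  by_contra hr0
  have hrI : ofPoly δ r ∈ I := by
    rw [← sub_eq_iff_eq_add'] at hq
    rw [← hq]
    exact I.sub_mem hh (I.smul_mem q hg)
  refine Nat.find_min hex (m := (ofPoly δ r).natDegree) ?_ ⟨_, hrI, hr0, rfl⟩
  rw [← hdeg]
  exact (natDegree_lt_iff_degree_lt hr0).mpr (mem_degreeLT.mp hr)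

/-- Ra + Rf has a single generator g. In a factorization f = ug one factor is a unit; if it were u,
then deg g = deg f, while g also divides the nonzero `a` of smaller degree. -/
theorem exists_bezout {f a : DiffPoly δ} (hf : Irreducible f) (ha : a ≠ 0)
    (hdeg : a.natDegree < f.natDegree) : ∃ b c, b * a + c * f = 1 := by
  obtain ⟨g, hg, hg0, hdvd⟩ := exists_generator (Submodule.span (DiffPoly δ) {a, f})
    (fun h => ha ((Submodule.mem_bot _).mp
      (h ▸ Submodule.subset_span (Set.mem_insert a {f}))))
  obtain ⟨u, hu⟩ := hdvd f (Submodule.subset_span (Set.mem_insert_of_mem _ rfl))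
  obtain ⟨v, hv⟩ := hdvd a (Submodule.subset_span (Set.mem_insert _ _))
  obtain ⟨b, c, hbc⟩ := Submodule.mem_span_pair.mp hg
  simp only [smul_eq_mul] at hbc
  rcases hf.isUnit_or_isUnit hu with h | h
  · have h1 : f.natDegree = g.natDegree := by
      rw [hu, natDegree_mul h.ne_zero hg0, natDegree_eq_zero_of_isUnit h, zero_add]
    have hv0 : v ≠ 0 := by rintro rfl; exact ha (by rw [hv, zero_mul])
    rw [hv, natDegree_mul hv0 hg0] at hdeg
    omega
  · obtain ⟨w, hw⟩ := h.exists_left_inv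
    exact ⟨w * b, w * c, by rw [mul_assoc, mul_assoc, ← mul_add, hbc, hw]⟩

end DiffPoly

/-! ### Absence of zero divisors for irreducible f -/

namespace Petit

variable {D : Type*} [DivisionRing D] {δ : RingDer D} {f : DiffPoly δ}

theorem val_smul_left (c : D) (x : Petit f) : val (c • x) = DiffPoly.C δ c * val x := by
  apply DiffPoly.toPoly.injective
  rw [DiffPoly.C_mul_eq, ← smul_eq_C_mul]
  rfl

theorem modr_C_mul (c : D) (g : DiffPoly δ) :
    modr f (DiffPoly.C δ c * g) = c • modr f g := by
  rw [← modr_mul_modr, ← val_smul_left, modr_val]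

theorem mul_ne_zero_of_irreducible (hf : Irreducible f) {x a : Petit f} (hx : x ≠ 0)
    (ha : a ≠ 0) : x * a ≠ 0 := by
  intro hxa
  have hf0 : f ≠ 0 := hf.ne_zero
  have hm : f.natDegree ≠ 0 := fun h => by
    have := subsingleton_of_natDegree h
    exact hx (Subsingleton.elim _ _)
  have hval : ∀ {y : Petit f}, y ≠ 0 → val y ≠ 0 := fun hy h =>
    hy (val_injective (by rw [h, map_zero]))
  obtain ⟨b, c, hbc⟩ := DiffPoly.exists_bezout hf (hval ha) (natDegree_val_lt hm a)
  -- the left ideal of all `h` with `h a ∈ R f`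
  let I : Submodule (DiffPoly δ) (DiffPoly δ) :=
    { carrier := {h | ∃ q, h * val a = q * f}
      add_mem' := by
        rintro g h ⟨q, hq⟩ ⟨q', hq'⟩
        exact ⟨q + q', by rw [add_mul, add_mul, hq, hq']⟩
      zero_mem' := ⟨0, by rw [zero_mul, zero_mul]⟩
      smul_mem' := by
        rintro g h ⟨q, hq⟩
        exact ⟨g * q, by rw [smul_eq_mul, mul_assoc, hq, mul_assoc]⟩ }
  have hxI : val x ∈ I := (modr_eq_zero_iff hf0).mp hxa
  obtain ⟨g, ⟨u, hu⟩, hg0, hdvd⟩ := DiffPoly.exists_generator I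
    (fun h => hval hx ((Submodule.mem_bot _).mp (h ▸ hxI)))
  have hlt : g.natDegree < f.natDegree := by
    obtain ⟨q, hq⟩ := hdvd _ hxI
    have hq0 : q ≠ 0 := by rintro rfl; exact hval hx (by rw [hq, zero_mul])
    have := natDegree_val_lt hm x
    rw [hq, DiffPoly.natDegree_mul hq0 hg0] at this
    omega
  -- On representatives this is the map R/Rg → R/Rf, h ↦ ha. If onto, it forces m ≤ deg g, contrary
  -- to `hlt`.
  let L : Petit g →ₗ[D] Petit f :=
    { toFun := fun y => modr f (val y * val a)
      map_add' := fun y z => by rw [map_add, add_mul, modr_add]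
      map_smul' := fun d y => by rw [val_smul_left, mul_assoc, modr_C_mul]; rfl }
  have hL : Function.Surjective L := by
    intro z
    -- Since ba + cf = 1, the element zb is sent to z modulo Rf; reducing zb modulo `g` is harmless
    -- because ga = uf.
    refine ⟨modr g (val z * b), ?_⟩
    obtain ⟨q, hq⟩ := modr_spec hg0 (val z * b)
    conv_rhs => rw [← modr_val z]
    refine (modr_eq_modr_iff hf0).mpr ⟨-(val z * c + q * u), ?_⟩
    rw [← sub_eq_iff_eq_add'] at hq
    rw [← hq]
    calc (val z * b - q * g) * val a - val z
        = val z * (b * val a) - q * (g * val a) - val z := by noncomm_ring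
      _ = val z * (1 - c * f) - q * (u * f) - val z := by rw [hu, ← hbc, add_sub_cancel_right]
      _ = _ := by noncomm_ring
  let e₁ : Petit g ≃ₗ[D] (Fin g.natDegree → D) := degreeLTEquiv D g.natDegree
  let e₂ : Petit f ≃ₗ[D] (Fin f.natDegree → D) := degreeLTEquiv D f.natDegree
  have : Module.Finite D (Petit g) := Module.Finite.equiv e₁.symm
  have h := LinearMap.finrank_le_finrank_of_surjective hL
  rw [e₁.finrank_eq, e₂.finrank_eq] at h
  simp only [Module.finrank_fin_fun] at h
  omega

end Petit

/-! ### Centrality of F and the F-algebra structure -/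

namespace DiffPoly

variable {D : Type*} [DivisionRing D] {δ : RingDer D}

theorem commute_C_constField (c : δ.constField) (g : DiffPoly δ) :
    g * C δ ((c : Subring.center D) : D) = C δ ((c : Subring.center D) : D) * g := by
  have ht : Commute (t δ) (C δ ((c : Subring.center D) : D)) := by
    change t δ * C δ _ = _
    rw [t_mul_C, show δ ((c : Subring.center D) : D) = 0 from c.2,
      show C δ (0 : D) = 0 from Polynomial.C_0, add_zero]
  have hc : ∀ a, Commute (C δ a) (C δ ((c : Subring.center D) : D)) := fun a => by
    change C δ a * C δ _ = _
    rw [← C_mul, ← C_mul, Subring.mem_center_iff.mp (c : Subring.center D).2 a]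
  change Commute g _
  induction g using DiffPoly.induction_on with
  | hadd g h hg hh => exact hg.add_left hh
  | ht a k => exact (hc a).mul_left (ht.pow_left k)

end DiffPoly

namespace Petit

variable {D : Type*} [DivisionRing D] {δ : RingDer D} {f : DiffPoly δ}

theorem val_constField_smul (c : δ.constField) (x : Petit f) :
    val (c • x) = DiffPoly.C δ ((c : Subring.center D) : D) * val x :=
  val_smul_left _ x

theorem modr_C_constField_mul (c : δ.constField) (g : DiffPoly δ) :
    modr f (DiffPoly.C δ ((c : Subring.center D) : D) * g) = c • modr f g :=
  modr_C_mul _ g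

instance isScalarTower_constField : IsScalarTower δ.constField (Petit f) (Petit f) where
  smul_assoc c x y := by
    rw [smul_eq_mul, smul_eq_mul, mul_def, mul_def, val_constField_smul, mul_assoc,
      modr_C_constField_mul]

instance smulCommClass_constField : SMulCommClass δ.constField (Petit f) (Petit f) where
  smul_comm c x y := by
    rw [smul_eq_mul, smul_eq_mul, mul_def, mul_def, val_constField_smul, ← mul_assoc,
      DiffPoly.commute_C_constField, mul_assoc, modr_C_constField_mul]

/-- Multiplications on either side are F-linear because F is central in R, so on a
finite-dimensional space injectivity suffices. -/
theorem isNonassocDivision_of_irreducible [FiniteDimensional δ.constField D] (hf : Irreducible f)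
    (hm : f.natDegree ≠ 0) : IsNonassocDivision (Petit f) := by
  have hfin : FiniteDimensional δ.constField (Petit f) := finiteDimensional _ f
  have h1 : (1 : Petit f) ≠ 0 := by
    intro h
    have h2 := val_modr_one hm
    rw [show modr f 1 = (1 : Petit f) from rfl, h, map_zero] at h2
    exact zero_ne_one h2
  refine ⟨⟨⟨1, 0, h1⟩⟩, fun a ha => ⟨?_, ?_⟩⟩
  · have hinj : Function.Injective (LinearMap.mulLeft δ.constField a) :=
      (injective_iff_map_eq_zero _).mpr fun x hx => by
        by_contra hx0
        exact mul_ne_zero_of_irreducible hf ha hx0 hx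
    exact ⟨hinj, LinearMap.injective_iff_surjective.mp hinj⟩
  · have hinj : Function.Injective (LinearMap.mulRight δ.constField a) :=
      (injective_iff_map_eq_zero _).mpr fun x hx => by
        by_contra hx0
        exact mul_ne_zero_of_irreducible hf hx0 ha hx
    exact ⟨hinj, LinearMap.injective_iff_surjective.mp hinj⟩

end Petit

/-! ### The subrings C[t;δ] and F[t] of D[t;δ] -/

namespace DiffPoly

section center

variable {D : Type*} [Ring D] {δ : RingDer D}

theorem map_tMul_pow (q : (Subring.center D)[X]) (k : ℕ) :
    ((tMul δ.toCenter ^ k) q).map (Subring.center D).subtype =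
      (tMul δ ^ k) (q.map (Subring.center D).subtype) := by
  induction k with
  | zero => rfl
  | succ k ih =>
    rw [pow_succ', pow_succ', end_mul, end_mul, ← ih]
    ext i
    rw [coeff_map, tMul_apply, tMul_apply, coeff_add, coeff_add, coeff_der, coeff_der, coeff_map,
      map_add, ← Polynomial.map_X (Subring.center D).subtype, ← Polynomial.map_mul, coeff_map]
    rfl

theorem ofCenter_mul (g h : DiffPoly δ.toCenter) :
    ofCenter δ (g * h) = ofCenter δ g * ofCenter δ h := by
  have H : ∀ p q : (Subring.center D)[X],
      (lMul δ.toCenter p q).map (Subring.center D).subtype =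
        lMul δ (p.map (Subring.center D).subtype) (q.map (Subring.center D).subtype) := by
    intro p q
    induction p using Polynomial.induction_on' with
    | add p r hp hr =>
      rw [map_add, end_add, Polynomial.map_add, hp, hr, Polynomial.map_add, map_add, end_add]
    | monomial k a =>
      rw [map_monomial, lMul_monomial, lMul_monomial, end_mul, end_mul, cMul_apply, cMul_apply,
        Polynomial.map_mul, map_tMul_pow, Polynomial.map_C]
  exact H g.toPoly h.toPoly

theorem ofCenter_add (g h : DiffPoly δ.toCenter) :
    ofCenter δ (g + h) = ofCenter δ g + ofCenter δ h :=
  Polynomial.map_add _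

theorem ofCenter_one : ofCenter δ (1 : DiffPoly δ.toCenter) = 1 :=
  Polynomial.map_one _

theorem ofCenter_injective : Function.Injective (ofCenter δ) :=
  Polynomial.map_injective _ Subtype.val_injective

theorem natDegree_ofCenter (g : DiffPoly δ.toCenter) : (ofCenter δ g).natDegree = g.natDegree :=
  natDegree_map_eq_of_injective (f := (Subring.center D).subtype) Subtype.val_injective g.toPoly

end center

section constants

variable {D : Type*} [DivisionRing D] {δ : RingDer D}

theorem ofConst_add (p q : (δ.constField)[X]) :
    ofConst δ (p + q) = ofConst δ p + ofConst δ q :=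
  Polynomial.map_add _

theorem ofConst_one : ofConst δ 1 = 1 :=
  Polynomial.map_one _

theorem ofConst_zero : ofConst δ 0 = 0 :=
  Polynomial.map_zero _

theorem ofConst_injective : Function.Injective (ofConst δ) :=
  Polynomial.map_injective _ (RingHom.injective _)

theorem natDegree_ofConst (p : (δ.constField)[X]) : (ofConst δ p).natDegree = p.natDegree :=
  natDegree_map_eq_of_injective (RingHom.injective _) p

theorem ofConst_C_mul (a : δ.constField) (q : (δ.constField)[X]) :
    ofConst δ (Polynomial.C a * q) =
      C δ ((a : Subring.center D) : D) * ofConst δ q := by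
  apply toPoly.injective
  rw [C_mul_eq]
  exact (Polynomial.map_mul _).trans (congrArg (· * _) (Polynomial.map_C _))

theorem ofConst_C (a : δ.constField) :
    ofConst δ (Polynomial.C a) = C δ ((a : Subring.center D) : D) :=
  Polynomial.map_C _

/-- δ kills the coefficients, so left multiplication by t is the ordinary shift. This is what makes
F[t] a commutative subring. -/
theorem ofConst_X_mul (q : (δ.constField)[X]) :
    ofConst δ (X * q) = t δ * ofConst δ q := by
  apply toPoly.injective
  rw [toPoly_t_mul]
  ext i
  rw [tMul_apply, coeff_add, coeff_der,
    show δ ((ofConst δ q).toPoly.coeff i) = 0 from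
      (congrArg δ (coeff_map _ i)).trans (q.coeff i).2, add_zero, mul_comm X q]
  change (Polynomial.map _ (q * X)).coeff i = _
  rw [Polynomial.map_mul, Polynomial.map_X]
  rfl

theorem ofConst_mul (p q : (δ.constField)[X]) :
    ofConst δ (p * q) = ofConst δ p * ofConst δ q := by
  induction p using Polynomial.induction_on generalizing q with
  | C a => rw [ofConst_C_mul, ofConst_C]
  | add p r hp hr => rw [add_mul, ofConst_add, ofConst_add, add_mul, hp, hr]
  | monomial k a ih =>
    have h : ofConst δ X = t δ := Polynomial.map_X _
    rw [pow_succ, ← mul_assoc, mul_assoc _ X q, ih, ofConst_X_mul, ih, h, mul_assoc]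

end constants

end DiffPoly

/-! ### Homomorphisms from F[t]/(f) and from the Petit algebra over C -/

namespace Petit

variable {D : Type*} [DivisionRing D] {δ : RingDer D}

section constants

variable {f₀ : (δ.constField)[X]}

/-- Euclidean division in F[t] is also a right division in R, and remainders there are unique. -/
theorem val_modr_ofConst (hf : 0 < f₀.natDegree) (q : (δ.constField)[X]) :
    val (modr (DiffPoly.ofConst δ f₀) (DiffPoly.ofConst δ q)) = DiffPoly.ofConst δ (q % f₀) := by
  have h0 : DiffPoly.ofConst δ f₀ ≠ 0 := by
    rw [← DiffPoly.ofConst_zero (δ := δ)]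
    refine DiffPoly.ofConst_injective.ne ?_
    rintro rfl
    exact lt_irrefl _ hf
  obtain ⟨x, hx⟩ := exists_val_eq (f := DiffPoly.ofConst δ f₀) (g := DiffPoly.ofConst δ (q % f₀))
    (by rw [DiffPoly.natDegree_ofConst, DiffPoly.natDegree_ofConst]
        exact natDegree_mod_lt _ hf.ne')
  rw [← hx]
  congr 1
  refine modr_unique h0 (q := DiffPoly.ofConst δ (q / f₀)) ?_
  rw [hx, ← DiffPoly.ofConst_mul, ← DiffPoly.ofConst_add, mul_comm, EuclideanDomain.div_add_mod]

theorem modr_ofConst_eq_iff (hf : 0 < f₀.natDegree) {p q : (δ.constField)[X]} :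
    modr (DiffPoly.ofConst δ f₀) (DiffPoly.ofConst δ p) =
        modr (DiffPoly.ofConst δ f₀) (DiffPoly.ofConst δ q) ↔
      Ideal.Quotient.mk (Ideal.span {f₀}) p = Ideal.Quotient.mk (Ideal.span {f₀}) q := by
  rw [← val_injective.eq_iff, val_modr_ofConst hf, val_modr_ofConst hf,
    DiffPoly.ofConst_injective.eq_iff, Ideal.Quotient.eq, Ideal.mem_span_singleton,
    ← EuclideanDomain.mod_eq_zero, sub_mod, sub_eq_zero]

theorem modr_ofConst_mul (p q : (δ.constField)[X]) (hf : 0 < f₀.natDegree) :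
    modr (DiffPoly.ofConst δ f₀) (DiffPoly.ofConst δ (p * q)) =
      modr (DiffPoly.ofConst δ f₀) (DiffPoly.ofConst δ p) *
        modr (DiffPoly.ofConst δ f₀) (DiffPoly.ofConst δ q) := by
  rw [mul_def, val_modr_ofConst hf, val_modr_ofConst hf, ← DiffPoly.ofConst_mul,
    modr_ofConst_eq_iff hf, map_mul, map_mul]
  congr 1 <;>
  · rw [Ideal.Quotient.eq, Ideal.mem_span_singleton]
    exact ⟨_, by rw [sub_eq_iff_eq_add, EuclideanDomain.div_add_mod]⟩

/-- The homomorphism `F[t]/(f₀) → S_f`, `q ↦ q mod_r f`, for `f = f₀ ∈ F[t]`. -/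
noncomputable def ofQuotient (hf : 0 < f₀.natDegree) :
    ((δ.constField)[X] ⧸ Ideal.span {f₀}) →ₙₐ[δ.constField] Petit (DiffPoly.ofConst δ f₀) :=
  -- An arbitrary section of the quotient map; by `hs` its choice disappears after reduction modulo
  -- `f`.
  let s : ((δ.constField)[X] ⧸ Ideal.span {f₀}) → (δ.constField)[X] :=
    Function.surjInv Ideal.Quotient.mk_surjective
  have hs : ∀ q, modr (DiffPoly.ofConst δ f₀)
      (DiffPoly.ofConst δ (s (Ideal.Quotient.mk (Ideal.span {f₀}) q))) =
        modr (DiffPoly.ofConst δ f₀) (DiffPoly.ofConst δ q) := fun q =>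
    (modr_ofConst_eq_iff hf).mpr (Function.surjInv_eq Ideal.Quotient.mk_surjective _)
  { toFun := fun x => modr (DiffPoly.ofConst δ f₀) (DiffPoly.ofConst δ (s x))
    map_smul' := fun c x => by
      obtain ⟨q, rfl⟩ := Ideal.Quotient.mk_surjective x
      refine Eq.trans (b := modr (DiffPoly.ofConst δ f₀) (DiffPoly.ofConst δ
        (s (Ideal.Quotient.mk (Ideal.span {f₀}) (Polynomial.C c * q))))) ?_ ?_
      · rw [← smul_eq_C_mul]; rfl
      · rw [hs, hs, DiffPoly.ofConst_C_mul, modr_C_constField_mul]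
        rfl
    map_zero' := by
      rw [← map_zero (Ideal.Quotient.mk (Ideal.span {f₀})), hs, DiffPoly.ofConst_zero, modr_zero]
    map_add' := fun x y => by
      obtain ⟨p, rfl⟩ := Ideal.Quotient.mk_surjective x
      obtain ⟨q, rfl⟩ := Ideal.Quotient.mk_surjective y
      rw [← map_add, hs, hs, hs, DiffPoly.ofConst_add, modr_add]
    map_mul' := fun x y => by
      obtain ⟨p, rfl⟩ := Ideal.Quotient.mk_surjective x
      obtain ⟨q, rfl⟩ := Ideal.Quotient.mk_surjective y
      rw [← map_mul, hs, hs, hs, modr_ofConst_mul _ _ hf] }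

theorem ofQuotient_mk (hf : 0 < f₀.natDegree) (q : (δ.constField)[X]) :
    ofQuotient hf (Ideal.Quotient.mk (Ideal.span {f₀}) q) =
      modr (DiffPoly.ofConst δ f₀) (DiffPoly.ofConst δ q) :=
  (modr_ofConst_eq_iff hf).mpr (Function.surjInv_eq Ideal.Quotient.mk_surjective _)

theorem ofQuotient_injective (hf : 0 < f₀.natDegree) :
    Function.Injective (ofQuotient (δ := δ) hf) := by
  intro x y h
  obtain ⟨p, rfl⟩ := Ideal.Quotient.mk_surjective x
  obtain ⟨q, rfl⟩ := Ideal.Quotient.mk_surjective y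
  rwa [ofQuotient_mk, ofQuotient_mk, modr_ofConst_eq_iff hf] at h

theorem range_ofQuotient (hf : 0 < f₀.natDegree) :
    Set.range (ofQuotient (δ := δ) hf) =
      {x | ∃ r : (δ.constField)[X], val x = DiffPoly.ofConst δ r} := by
  ext x
  constructor
  · rintro ⟨y, rfl⟩
    obtain ⟨p, rfl⟩ := Ideal.Quotient.mk_surjective y
    exact ⟨p % f₀, by rw [ofQuotient_mk, val_modr_ofConst hf]⟩
  · rintro ⟨r, hr⟩
    exact ⟨Ideal.Quotient.mk _ r, by rw [ofQuotient_mk, ← hr, modr_val]⟩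

theorem range_ofQuotient_subset_rightNucleus (hf : 0 < f₀.natDegree) :
    Set.range (ofQuotient (δ := δ) hf) ⊆ rightNucleus (Petit (DiffPoly.ofConst δ f₀)) := by
  rw [range_ofQuotient]
  rintro x ⟨r, hr⟩
  refine mem_rightNucleus_of_mul_eq (s := DiffPoly.ofConst δ r) ?_ ?_
  · rw [← DiffPoly.ofConst_zero (δ := δ)]
    refine DiffPoly.ofConst_injective.ne ?_
    rintro rfl
    exact lt_irrefl _ hf
  -- Commutativity of F[t] gives f r = r f, hence membership in the right nucleus.
  · rw [hr, ← DiffPoly.ofConst_mul, mul_comm, DiffPoly.ofConst_mul]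

end constants

section center

variable {f₁ : DiffPoly δ.toCenter}

theorem val_modr_ofCenter (hf : f₁.natDegree ≠ 0) (x : Petit f₁) :
    val (modr (DiffPoly.ofCenter δ f₁) (DiffPoly.ofCenter δ (val x))) =
      DiffPoly.ofCenter δ (val x) := by
  obtain ⟨y, hy⟩ := exists_val_eq (f := DiffPoly.ofCenter δ f₁) (g := DiffPoly.ofCenter δ (val x))
    (by rw [DiffPoly.natDegree_ofCenter, DiffPoly.natDegree_ofCenter]
        exact natDegree_val_lt hf x)
  rw [← hy, modr_val]

theorem ofCenter_C_mul (c : Subring.center D) (g : DiffPoly δ.toCenter) :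
    DiffPoly.ofCenter δ (DiffPoly.C δ.toCenter c * g) =
      DiffPoly.C δ (c : D) * DiffPoly.ofCenter δ g := by
  rw [DiffPoly.ofCenter_mul]
  exact congrArg (· * _) (Polynomial.map_C (Subring.center D).subtype)

/-- The homomorphism of Petit algebras induced by the inclusion `C ⊆ D` of the center. -/
noncomputable def mapCenter (hf : f₁.natDegree ≠ 0) :
    Petit f₁ →ₙₐ[δ.constField] Petit (DiffPoly.ofCenter δ f₁) where
  toFun x := modr (DiffPoly.ofCenter δ f₁) (DiffPoly.ofCenter δ (val x))
  map_smul' c x := by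
    have h : val (c • x) = DiffPoly.C δ.toCenter (c : Subring.center D) * val x :=
      val_smul_left _ x
    rw [h, ofCenter_C_mul, modr_C_constField_mul]
    rfl
  map_zero' := by
    rw [map_zero]
    exact (congrArg _ (Polynomial.map_zero _)).trans modr_zero
  map_add' x y := by rw [map_add, DiffPoly.ofCenter_add, modr_add]
  map_mul' x y := by
    have h0 : f₁ ≠ 0 := by rintro rfl; exact hf natDegree_zero
    have h1 : DiffPoly.ofCenter δ f₁ ≠ 0 := fun h => by
      have h2 := DiffPoly.natDegree_ofCenter f₁
      rw [h] at h2
      exact hf h2.symm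
    rw [mul_def _ (modr _ _), val_modr_ofCenter hf, val_modr_ofCenter hf,
      ← DiffPoly.ofCenter_mul]
    -- The division identity over C, read in D[t;δ], shows that both remainders agree modulo `f`.
    obtain ⟨q, hq⟩ := modr_spec h0 (val x * val y)
    refine ((modr_eq_modr_iff h1).mpr ⟨DiffPoly.ofCenter δ q, ?_⟩).symm
    rw [← DiffPoly.ofCenter_mul, sub_eq_iff_eq_add, ← DiffPoly.ofCenter_add, mul_def, ← hq]

theorem val_mapCenter (hf : f₁.natDegree ≠ 0) (x : Petit f₁) :
    val (mapCenter hf x) = DiffPoly.ofCenter δ (val x) :=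
  val_modr_ofCenter hf x

theorem mapCenter_injective (hf : f₁.natDegree ≠ 0) : Function.Injective (mapCenter hf) := by
  intro x y h
  have h2 := congrArg val h
  rw [val_mapCenter, val_mapCenter] at h2
  exact val_injective (DiffPoly.ofCenter_injective h2)

end center

end Petit

/-! ### The main theorem -/

theorem mainTheorem5 {D : Type*} [DivisionRing D] (p : ℕ) [Fact p.Prime] [CharP D p]
    (n e m : ℕ) [FiniteDimensional (Subring.center D) D]
    (hn : Module.finrank (Subring.center D) D = n ^ 2)
    (δ : RingDer D) (hδ : IsAlgebraic δ.constField δ.centerLin)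
    (hdeg : (minpoly δ.constField δ.centerLin).natDegree = p ^ e)
    (f : DiffPoly δ) (hf : f.natDegree = m) (hm : 2 ≤ m) :
    -- `S_f` is a unital algebra over `F` of dimension `m n² pᵉ`
    (IsScalarTower δ.constField (Petit f) (Petit f) ∧
      SMulCommClass δ.constField (Petit f) (Petit f) ∧
      Petit.val (1 : Petit f) = 1 ∧
      Module.finrank δ.constField (Petit f) = m * n ^ 2 * p ^ e) ∧
    (Irreducible f → IsNonassocDivision (Petit f)) ∧
    (¬ f.IsTwoSided →
      leftNucleus (Petit f) = Petit.constants f ∧ middleNucleus (Petit f) = Petit.constants f) ∧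
    (Petit.constants f ⊆ rightNucleus (Petit f) ↔ f.IsSemiInvariant) ∧
    -- the case `f ∈ F[t]`
    (∀ f₀ : (δ.constField)[X], f = DiffPoly.ofConst δ f₀ →
      (∃ φ : ((δ.constField)[X] ⧸ Ideal.span {f₀}) →ₙₐ[δ.constField] Petit f,
        Function.Injective φ ∧ φ 1 = 1 ∧
        (∀ q : (δ.constField)[X],
          φ (Ideal.Quotient.mk (Ideal.span {f₀}) q) = Petit.modr f (DiffPoly.ofConst δ q)) ∧
        Set.range φ = {x | ∃ r : (δ.constField)[X], Petit.val x = DiffPoly.ofConst δ r} ∧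
        Set.range φ ⊆ rightNucleus (Petit f)) ∧
      (Irreducible f₀ → IsField ((δ.constField)[X] ⧸ Ideal.span {f₀}) ∧
        Module.finrank δ.constField ((δ.constField)[X] ⧸ Ideal.span {f₀}) = m)) ∧
    -- the case `f ∈ C[t;δ]`
    (∀ f₁ : DiffPoly δ.toCenter, f = DiffPoly.ofCenter δ f₁ →
      (∃ ψ : Petit f₁ →ₙₐ[δ.constField] Petit f,
        Function.Injective ψ ∧ ψ 1 = 1 ∧
        ∀ x : Petit f₁, Petit.val (ψ x) = DiffPoly.ofCenter δ (Petit.val x)) ∧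
      Module.finrank δ.constField (Petit f₁) = m * p ^ e) := by

  obtain ⟨hfinC, hrankC⟩ := δ.finrank_center hδ
  have hrankD : Module.finrank δ.constField D = p ^ e * n ^ 2 := by
    rw [← Module.finrank_mul_finrank δ.constField (Subring.center D) D, hrankC, hdeg, hn]
  have hfinD : FiniteDimensional δ.constField D :=
    FiniteDimensional.trans δ.constField (Subring.center D) D
  subst hf
  have hm0 : f.natDegree ≠ 0 := by omega
  refine ⟨⟨inferInstance, inferInstance, Petit.val_modr_one hm0, ?_⟩,
    fun h => Petit.isNonassocDivision_of_irreducible h hm0,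
    fun h => ⟨Petit.leftNucleus_eq hm h, Petit.middleNucleus_eq hm h⟩,
    Petit.constants_subset_rightNucleus_iff hm, ?_, ?_⟩
  · refine (Petit.finrank_eq δ.constField f).trans ?_
    rw [hrankD]
    ring
  · rintro f₀ rfl
    rw [DiffPoly.natDegree_ofConst] at hm0
    have hpos := Nat.pos_of_ne_zero hm0
    refine ⟨⟨Petit.ofQuotient hpos, Petit.ofQuotient_injective hpos, ?_,
      Petit.ofQuotient_mk hpos, Petit.range_ofQuotient hpos,
      Petit.range_ofQuotient_subset_rightNucleus hpos⟩, fun hirr => ⟨?_, ?_⟩⟩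
    · rw [← map_one (Ideal.Quotient.mk (Ideal.span {f₀})), Petit.ofQuotient_mk,
        DiffPoly.ofConst_one]
      rfl
    · exact (Ideal.Quotient.maximal_ideal_iff_isField_quotient _).mp
        (PrincipalIdealRing.isMaximal_of_irreducible hirr)
    · rw [finrank_quotient_span_eq_natDegree, DiffPoly.natDegree_ofConst]
  · rintro f₁ rfl
    rw [DiffPoly.natDegree_ofCenter] at hm0
    refine ⟨⟨Petit.mapCenter hm0, Petit.mapCenter_injective hm0, ?_, Petit.val_mapCenter hm0⟩, ?_⟩
    · apply Petit.val_injective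
      rw [Petit.val_mapCenter]
      refine (congrArg (DiffPoly.ofCenter δ) (Petit.val_modr_one hm0)).trans ?_
      refine DiffPoly.ofCenter_one.trans (Petit.val_modr_one ?_).symm
      rwa [DiffPoly.natDegree_ofCenter]
    · refine (Petit.finrank_eq δ.constField f₁).trans ?_
      rw [DiffPoly.natDegree_ofCenter, hrankC, hdeg]
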